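/- Let $K$ be a differential field of characteristic zero with derivation $\partial$ whose field of constants $C$ is algebraically closed, and let $\lambda,\mu$ be variables over $K$ with $\partial\lambda=\partial\mu=0$. KdV hierarchy. In $C\{u\}=C[u,u',u'',\dots]$ let $\partial^{-1}$ denote the antiderivative without constant term, and put $\mathrm{kdv}_0=u'$, $\mathrm{kdv}_{n+1}=-\tfrac14\mathrm{kdv}_n''+u\,\mathrm{kdv}_n+\tfrac12u'\,\partial^{-1}(\mathrm{kdv}_n)$, $v_0=1$, $v_{n+1}=-\tfrac14v_n''+u\,v_n-\tfrac12\partial^{-1}(u'v_n)$. In $C\{u\}[\partial]$ put $L=-\partial^2+u$, $P_1=\partial$ and $P_{2n+1}=v_n\partial-\tfrac12v_n'+P_{2n-1}L$ for $n\ge1$. For constants $c=(c_1,\dots,c_n)\in C^n$ put $\mathrm{KdV}_n(u,c)=\mathrm{kdv}_n+\sum_{l=0}^{n-1}c_{n-l}\mathrm{kdv}_l$ and $\hat P_{2n+1}(u,c)=P_{2n+1}+\sum_{l=0}^{n-1}c_{n-l}P_{2l+1}$. Let $u_s\in K$ be a KdV potential of level $s$, that is, $s$ is the smallest integer $n\ge1$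 for which some $c\in C^n$ satisfies $\mathrm{KdV}_n(u_s,c)=0$, and let $\bar c\in C^s$ satisfy $\mathrm{KdV}_s(u_s,\bar c)=0$. Put $L_s=-\partial^2+u_s$ and $A_{2s+1}=\hat P_{2s+1}(u_s,\bar c)$ in $K[\partial]$. Subresultants. Write $P=L_s-\lambda$ and $Q=A_{2s+1}-\mu$, operators of orders $2$ and $2s+1$ in $K[\lambda,\mu][\partial]$. For $k=0,1$ let $S_k$ be the matrix whose rows are the coefficient vectors of $\partial^{2s-k}P,\dots,\partial P,P,\partial^{1-k}Q,\dots,Q$, with columns indexed by $\partial^{2s+2-k},\dots,\partial,1$. Let $f_s=\det S_0$ be the differential resultant, and let $\varphi_1=\det S_1^0$ and $\varphi_2=\det S_1^1$, where $S_1^0$ and $S_1^1$ are obtained from $S_1$ by removing the column indexed by $\partial$ and by $1$, respectively. Let $K(\Gamma_s)$ be the fraction field of $K[\lambda,\mu]/(f_s)$, and let $\phi_s=-\varphi_1/\varphi_2$ in $K(\Gamma_s)$. Then $K[\lambda,\mu]/(f_s)$ is an integral domain, and there are polynomials $\alpha,\varphi\in K[\lambda]$ such that $\varphi_1=-\mu-\alpha$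 and $\varphi_2=\varphi$; here $\varphi\ne0$, also in $K(\Gamma_s)$, and $\alpha\neq0$ provided that $u_s$ is not a constant. Consequently $$\phi_s=\frac{\mu+\alpha(\lambda)}{\varphi(\lambda)}\quad\text{in }K(\Gamma_s).$$ Moreover $\phi_s$ is nonzero in $K(\Gamma_s)$. -/

import Mathlib

open Polynomial
open scoped Polynomial.Bivariate

namespace KdV

noncomputable section

/-! ### Differential operators

For a commutative ring `E` with derivation `d`, an element `∑ aᵢ ∂ⁱ` of `E[∂]` is stored through its
coefficients as the polynomial `∑ aᵢ Xⁱ : E[X]`. The product of operators is `opMul` (it is *not* the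
product of polynomials); the order of an operator is the `natDegree`. -/

/-- The extension of a derivation `d` of `A` to `A[X]` with `d X = 0`: `∑ aᵢ Xⁱ ↦ ∑ d aᵢ Xⁱ`. -/
def coeffDeriv {k A : Type*} [CommRing k] [CommRing A] [Algebra k A] (d : Derivation k A A) :
    Derivation k A[X] A[X] :=
  (PolynomialModule.equivPolynomialSelf (R := A)).toLinearMap.compDer d.mapCoeffs

theorem coeff_coeffDeriv {k A : Type*} [CommRing k] [CommRing A] [Algebra k A]
    (d : Derivation k A A) (p : A[X]) (i : ℕ) :
    (coeffDeriv d p).coeff i = d (p.coeff i) := rfl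

/-- The operator `∂ P`, computed with the rule `∂ a = a ∂ + d a`:
if `P = ∑ aᵢ ∂ⁱ`, then `∂ P = ∑ aᵢ ∂ⁱ⁺¹ + ∑ (d aᵢ) ∂ⁱ`. -/
def dMul {k E : Type*} [CommRing k] [CommRing E] [Algebra k E] (d : Derivation k E E)
    (P : E[X]) : E[X] :=
  X * P + coeffDeriv d P

/-- The product `P Q = ∑ aᵢ (∂ⁱ Q)` in `E[∂]` of `P = ∑ aᵢ ∂ⁱ` and `Q`. -/
def opMul {k E : Type*} [CommRing k] [CommRing E] [Algebra k E] (d : Derivation k E E)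
    (P Q : E[X]) : E[X] :=
  P.sum fun i a => C a * (dMul d)^[i] Q

/-! ### Subresultants of differential operators -/

/-- The matrix `S_r(P,Q)`, where `P` and `Q` are operators of orders `n` and `m`: its rows are the
coefficient vectors of `∂^(m-1-r) P, …, ∂ P, P, ∂^(n-1-r) Q, …, ∂ Q, Q`, its columns are indexed by
`∂^(n+m-r-1), …, ∂, 1`, in this order. -/
def sylMatrix {k E : Type*} [CommRing k] [CommRing E] [Algebra k E] (d : Derivation k E E)
    (n m : ℕ) (P Q : E[X]) (r : ℕ) : Matrix (Fin (n + m - 2 * r)) (Fin (n + m - r)) E :=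
  Matrix.of fun a b =>
    (if (a : ℕ) < m - r then (dMul d)^[m - 1 - r - a] P
      else (dMul d)^[n - 1 - r - (a - (m - r))] Q).coeff (n + m - r - 1 - b)

/-- The square matrix `S_r^i(P,Q)` for `i ≤ r`: the columns of `S_r(P,Q)` indexed by
`∂^r, …, ∂, 1` are removed, except for the column indexed by `∂^i`. What is left are the columns at
the positions `0, …, n+m-2r-2` and the column at the position `n+m-r-1-i`. -/
def sylMinor {k E : Type*} [CommRing k] [CommRing E] [Algebra k E] (d : Derivation k E E)
    (n m : ℕ) (P Q : E[X]) (r i : ℕ) :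
    Matrix (Fin (n + m - 2 * r)) (Fin (n + m - 2 * r)) E :=
  (sylMatrix d n m P Q r).submatrix id fun b =>
    if (b : ℕ) + 1 < n + m - 2 * r then ⟨b, by have := b.2; omega⟩
    else ⟨n + m - r - 1 - i, by have := b.2; omega⟩

/-- `det S_r^i(P,Q)`, the coefficient of `∂^i` in the `r`-th subresultant of `P` and `Q`. -/
def subresDet {k E : Type*} [CommRing k] [CommRing E] [Algebra k E] (d : Derivation k E E)
    (P Q : E[X]) (r i : ℕ) : E :=
  (sylMinor d P.natDegree Q.natDegree P Q r i).det

/-- The differential resultant `∂Res(P,Q) = det S_0(P,Q)` (note that `S_0^0 = S_0`). -/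
def dRes {k E : Type*} [CommRing k] [CommRing E] [Algebra k E] (d : Derivation k E E)
    (P Q : E[X]) : E :=
  subresDet d P Q 0 0

/-! ### The KdV hierarchy in the differential polynomials `k{u} = k[u, u', u'', …]` -/

/-- The derivation of `k{u}`; the variable `X i` is the `i`-th derivative of `u`. -/
def diffPolyDeriv (k : Type*) [CommRing k] :
    Derivation k (MvPolynomial ℕ k) (MvPolynomial ℕ k) :=
  MvPolynomial.mkDerivation k fun i => MvPolynomial.X (i + 1)

open Classical in
/-- `∂⁻¹ p`: the antiderivative of `p` in `k{u}` without constant term (and the default value `0`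
if `p` is not a total derivative). -/
def antideriv {k : Type*} [CommRing k] (p : MvPolynomial ℕ k) : MvPolynomial ℕ k :=
  if h : ∃ q, diffPolyDeriv k q = p ∧ MvPolynomial.constantCoeff q = 0 then h.choose else 0

/-- `kdv₀ = u'`, `kdvₙ₊₁ = R (kdvₙ)` with `R = -(1/4) ∂² + u + (1/2) u' ∂⁻¹`. -/
def kdv (k : Type*) [Field k] : ℕ → MvPolynomial ℕ k
  | 0 => MvPolynomial.X 1
  | n + 1 =>
    -((1 / 4 : k) • diffPolyDeriv k (diffPolyDeriv k (kdv k n)))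
      + MvPolynomial.X 0 * kdv k n
      + (1 / 2 : k) • (MvPolynomial.X 1 * antideriv (kdv k n))

/-- `v₀ = 1`, `vₙ₊₁ = R* (vₙ)` with `R* = -(1/4) ∂² + u - (1/2) ∂⁻¹ u'`. -/
def v (k : Type*) [Field k] : ℕ → MvPolynomial ℕ k
  | 0 => 1
  | n + 1 =>
    -((1 / 4 : k) • diffPolyDeriv k (diffPolyDeriv k (v k n)))
      + MvPolynomial.X 0 * v k n
      - (1 / 2 : k) • antideriv (MvPolynomial.X 1 * v k n)

/-- The Schrödinger operator `-∂² + u` with potential `u` in a ring `E`. -/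
def schrodinger {E : Type*} [CommRing E] (u : E) : E[X] := -X ^ 2 + C u

/-- The operator `P_{2n+1}` in `k{u}[∂]`:
`P₁ = ∂`, `P_{2n+3} = vₙ₊₁ ∂ - (1/2) ∂(vₙ₊₁) + P_{2n+1} L` with `L = -∂² + u`. -/
def kdvOp (k : Type*) [Field k] : ℕ → (MvPolynomial ℕ k)[X]
  | 0 => X
  | n + 1 =>
    C (v k (n + 1)) * X - C ((1 / 2 : k) • diffPolyDeriv k (v k (n + 1)))
      + opMul (diffPolyDeriv k) (kdvOp k n) (schrodinger (MvPolynomial.X 0))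

/-- `KdVₙ(u,c) = kdvₙ + ∑_{l<n} c_{n-l} kdv_l`. The entry `c i` stands for the constant `c_{i+1}`, so
that `c_{n-l}` is `c (Fin.rev l)`. -/
def kdvPoly {k : Type*} [Field k] (n : ℕ) (c : Fin n → k) : MvPolynomial ℕ k :=
  kdv k n + ∑ l : Fin n, c l.rev • kdv k l

/-- `P̂_{2n+1}(u,c) = P_{2n+1} + ∑_{l<n} c_{n-l} P_{2l+1}`. -/
def kdvOpHat {k : Type*} [Field k] (n : ℕ) (c : Fin n → k) : (MvPolynomial ℕ k)[X] :=
  kdvOp k n + ∑ l : Fin n, c l.rev • kdvOp k l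

/-! ### KdV potentials in a differential field -/

section Potential

variable {k K : Type*} [Field k] [Field K] [Algebra k K] (d : Derivation k K K)

/-- The specialization `k{u} → K` that sends `u⁽ⁱ⁾` to the `i`-th derivative of the potential. -/
def evalAt (u : K) : MvPolynomial ℕ k →ₐ[k] K :=
  MvPolynomial.aeval fun i => d^[i] u

/-- `Hₙ`: the vectors of constants `c` with `KdVₙ(u,c) = 0`. -/
def constantsSet (u : K) (n : ℕ) : Set (Fin n → k) :=
  {c | evalAt d u (kdvPoly n c) = 0}

/-- `u` is a KdV potential of level `s`: `s` is the smallest positive integer with `H_s ≠ ∅`. -/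
def IsKdVPotential (u : K) (s : ℕ) : Prop :=
  IsLeast {n : ℕ | 1 ≤ n ∧ (constantsSet d u n).Nonempty} s

/-- The operator `A_{2s+1} = P̂_{2s+1}(u,c)` in `K[∂]`. -/
def opA (u : K) (s : ℕ) (c : Fin s → k) : K[X] :=
  (kdvOpHat s c).map (evalAt d u : MvPolynomial ℕ k →+* K)

/-! ### The spectral curve

`K[λ, μ]` is `K[X][Y]`, where `λ` is `C X` and `μ` is the outer variable `Y`. -/

/-- The derivation of `K[λ,μ]` that extends the one of `K`, with `∂ λ = ∂ μ = 0`. -/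
def polyDeriv : Derivation k K[X][Y] K[X][Y] := coeffDeriv (coeffDeriv d)

/-- The operator `L - λ` in `K[λ,μ][∂]`, where `L = -∂² + u`. -/
def opLsubLambda (u : K) : K[X][Y][X] :=
  (schrodinger u).map ((C : K[X] →+* K[X][Y]).comp C) - C (C X)

/-- The operator `A_{2s+1} - μ` in `K[λ,μ][∂]`. -/
def opAsubMu (u : K) (s : ℕ) (c : Fin s → k) : K[X][Y][X] :=
  (opA d u s c).map ((C : K[X] →+* K[X][Y]).comp C) - C Y

/-- `f_s(λ,μ) = ∂Res(L - λ, A_{2s+1} - μ)`, which defines the spectral curve `Γ_s`. -/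
def spectralPoly (u : K) (s : ℕ) (c : Fin s → k) : K[X][Y] :=
  dRes (polyDeriv d) (opLsubLambda u) (opAsubMu d u s c)

/-- `φ₁ = det S_1^0(L - λ, A_{2s+1} - μ)`, the coefficient of `1` in the first subresultant. -/
def phi1 (u : K) (s : ℕ) (c : Fin s → k) : K[X][Y] :=
  subresDet (polyDeriv d) (opLsubLambda u) (opAsubMu d u s c) 1 0

/-- `φ₂ = det S_1^1(L - λ, A_{2s+1} - μ)`, the coefficient of `∂` in the first subresultant. -/
def phi2 (u : K) (s : ℕ) (c : Fin s → k) : K[X][Y] :=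
  subresDet (polyDeriv d) (opLsubLambda u) (opAsubMu d u s c) 1 1

/-- `K[Γ_s] = K[λ,μ]/(f_s)`; `AdjoinRoot f` is the quotient of `K[λ][μ]` by the ideal `(f)`. -/
abbrev CoordRing (u : K) (s : ℕ) (c : Fin s → k) : Type _ :=
  AdjoinRoot (spectralPoly d u s c)

/-- `K(Γ_s)`, the fraction field of `K[Γ_s]`. -/
abbrev FunctionField (u : K) (s : ℕ) (c : Fin s → k) : Type _ :=
  FractionRing (CoordRing d u s c)

/-- The canonical map `K[λ,μ] → K(Γ_s)`. -/
def toFunctionField (u : K) (s : ℕ) (c : Fin s → k) : K[X][Y] →+* FunctionField d u s c :=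
  (algebraMap (CoordRing d u s c) (FunctionField d u s c)).comp
    (AdjoinRoot.mk (spectralPoly d u s c))

/-- `φ_s = -φ₁/φ₂` in `K(Γ_s)`. -/
def factorCoeff (u : K) (s : ℕ) (c : Fin s → k) [IsDomain (CoordRing d u s c)] :
    FunctionField d u s c :=
  -(toFunctionField d u s c (phi1 d u s c)) / toFunctionField d u s c (phi2 d u s c)

end Potential

end

end KdV

/-! The rows of a differential Sylvester matrix built from `Q` can be reduced by those built from
`P`, so every subresultant is, up to a power of the leading coefficient of `P`, a minor of the
coefficients of the remainders of `∂ⁱ Q` on right division by `P` (`subresDet_eq_of_remainders`).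
Everything is therefore read off from one division.

Write `L = (L - λ) + λ` in `P_{2n+3} = v ∂ - v'/2 + P_{2n+1} L`, with `v = vₙ₊₁`. Since `λ` is a
constant, the remainders satisfy `Rₙ₊₁ = (v ∂ - v'/2) + λ Rₙ`, so each has the form `V ∂ - V'/2`
with `V` monic of degree `n` in `λ` (`map_kdvOp_eq`). Combining with the constants `c`, the
remainder of `A_{2s+1} - μ` is `φ ∂ - (μ + α)` with `φ` monic of degree `s` and `α = φ'/2`
(`opAsubMu_eq`); its two coefficients are `φ₂` and `φ₁`.

The resultant is a 2×2 determinant equal to `-(μ² - R)`, where `R = α² - φ α' + φ² (u - λ)` has odd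
degree `2s+1` in `λ` (`spectralPoly_eq`, `natDegree_curve`). Hence `R` is no square and `f_s` is
prime. Nonzero polynomials of degree below 2 in `μ`, such as `φ` and `μ + α`, survive in `K(Γ_s)`.
Finally the coefficient of `λ^(s-1)` in `φ` is `v₁` plus a constant, with derivative `u'/2`, so `α ≠
0` when `u' ≠ 0`. -/

namespace KdV

/-! ### Arithmetic of differential operators -/

section Operators

variable {k E : Type*} [CommRing k] [CommRing E] [Algebra k E] (d : Derivation k E E)

theorem coeffDeriv_C (a : E) : coeffDeriv d (C a) = C (d a) := by
  ext i
  simp only [coeff_coeffDeriv, coeff_C]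
  split_ifs <;> simp

theorem coeffDeriv_X : coeffDeriv d (X : E[X]) = 0 := by
  ext i
  simp only [coeff_coeffDeriv, coeff_X]
  split_ifs <;> simp

theorem natDegree_coeffDeriv_le (p : E[X]) : (coeffDeriv d p).natDegree ≤ p.natDegree := by
  refine natDegree_le_iff_coeff_eq_zero.2 fun i hi => ?_
  rw [coeff_coeffDeriv, coeff_eq_zero_of_natDegree_lt hi, map_zero]

theorem dMul_add (p q : E[X]) : dMul d (p + q) = dMul d p + dMul d q := by
  simp only [dMul, map_add]; ring

theorem dMul_C_mul (a : E) (p : E[X]) :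
    dMul d (C a * p) = C a * dMul d p + C (d a) * p := by
  simp only [dMul, Derivation.leibniz, coeffDeriv_C, smul_eq_mul]; ring

theorem iterate_dMul_add (i : ℕ) (p q : E[X]) :
    (dMul d)^[i] (p + q) = (dMul d)^[i] p + (dMul d)^[i] q :=
  Function.Semiconj₂.iterate (f := dMul d) (op := (· + ·)) (dMul_add d) i p q

theorem iterate_dMul_C {a : E} (ha : d a = 0) (i : ℕ) : (dMul d)^[i] (C a) = C a * X ^ i := by
  induction i with
  | zero => simp
  | succ i ih =>
    rw [Function.iterate_succ_apply', ih, dMul_C_mul, ha]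
    simp [dMul, coeffDeriv_X, pow_succ']

theorem coeff_dMul_succ (p : E[X]) (i : ℕ) :
    (dMul d p).coeff (i + 1) = p.coeff i + d (p.coeff (i + 1)) := by
  simp [dMul, coeff_X_mul, coeff_coeffDeriv]

theorem natDegree_iterate_dMul_le {n : ℕ} {p : E[X]} (hp : p.natDegree ≤ n) (i : ℕ) :
    ((dMul d)^[i] p).natDegree ≤ n + i := by
  induction i with
  | zero => simpa
  | succ i ih =>
    rw [Function.iterate_succ_apply', dMul]
    refine (natDegree_add_le_of_degree_le (n := n + i + 1) ?_ ?_)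
    · exact natDegree_mul_le.trans (by have := natDegree_X_le (R := E); omega)
    · exact (natDegree_coeffDeriv_le d _).trans (by omega)

theorem coeff_iterate_dMul_top {n : ℕ} {p : E[X]} (hp : p.natDegree ≤ n) (i : ℕ) :
    ((dMul d)^[i] p).coeff (n + i) = p.coeff n := by
  induction i with
  | zero => simp
  | succ i ih =>
    have h : ((dMul d)^[i] p).coeff (n + i + 1) = 0 :=
      coeff_eq_zero_of_natDegree_lt ((natDegree_iterate_dMul_le d hp i).trans_lt (by omega))
    rw [Function.iterate_succ_apply', ← add_assoc, coeff_dMul_succ, ih, h, map_zero, add_zero]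

theorem opMul_eq_sum_range {N : ℕ} {p : E[X]} (hp : p.degree < N) (q : E[X]) :
    opMul d p q = ∑ i ∈ Finset.range N, C (p.coeff i) * (dMul d)^[i] q := by
  refine sum_eq_of_subset (p := p) (f := fun i a => C a * (dMul d)^[i] q) (by simp) fun i hi => ?_
  rw [Finset.mem_range]
  by_contra h
  rw [mem_support_iff] at hi
  exact hi (coeff_eq_zero_of_degree_lt (hp.trans_le (by exact_mod_cast not_lt.1 h)))

theorem opMul_monomial (i : ℕ) (a : E) (q : E[X]) :
    opMul d (monomial i a) q = C a * (dMul d)^[i] q :=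
  sum_monomial_index a _ (by simp)

theorem opMul_C (a : E) (q : E[X]) : opMul d (C a) q = C a * q :=
  opMul_monomial d 0 a q

theorem opMul_zero_left (q : E[X]) : opMul d 0 q = 0 := sum_zero_index _

theorem opMul_add_left (p₁ p₂ q : E[X]) :
    opMul d (p₁ + p₂) q = opMul d p₁ q + opMul d p₂ q :=
  sum_add_index _ _ _ (by simp) fun i a b => by rw [C_add, add_mul]

theorem opMul_add_right (p q₁ q₂ : E[X]) :
    opMul d p (q₁ + q₂) = opMul d p q₁ + opMul d p q₂ := by
  simp only [opMul, iterate_dMul_add, mul_add, Polynomial.sum_def, Finset.sum_add_distrib]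

theorem opMul_C_mul_left (a : E) (p q : E[X]) :
    opMul d (C a * p) q = C a * opMul d p q := by
  induction p using Polynomial.induction_on' with
  | add p₁ p₂ h₁ h₂ => rw [mul_add, opMul_add_left, opMul_add_left, h₁, h₂, mul_add]
  | monomial i b => rw [C_mul_monomial, opMul_monomial, opMul_monomial, C_mul, mul_assoc]

theorem opMul_sum_left {ι : Type*} (t : Finset ι) (p : ι → E[X]) (q : E[X]) :
    opMul d (∑ i ∈ t, p i) q = ∑ i ∈ t, opMul d (p i) q := by
  classical
  induction t using Finset.induction_on with
  | empty => simp [opMul_zero_left]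
  | insert i t hi ih => rw [Finset.sum_insert hi, Finset.sum_insert hi, opMul_add_left, ih]

theorem opMul_C_right {a : E} (ha : d a = 0) (p : E[X]) : opMul d p (C a) = C a * p := by
  induction p using Polynomial.induction_on' with
  | add p₁ p₂ h₁ h₂ => rw [opMul_add_left, h₁, h₂, mul_add]
  | monomial i b => rw [opMul_monomial, iterate_dMul_C d ha, ← C_mul_X_pow_eq_monomial]; ring

/-- The one case of associativity that is needed: it turns a division of `Q` into a division of `∂
Q`. -/
theorem dMul_opMul (p q : E[X]) : dMul d (opMul d p q) = opMul d (dMul d p) q := by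
  induction p using Polynomial.induction_on' with
  | add p₁ p₂ h₁ h₂ => rw [opMul_add_left, dMul_add, dMul_add, opMul_add_left, h₁, h₂]
  | monomial i b =>
    have h : dMul d (monomial i b) = monomial (i + 1) b + monomial i (d b) := by
      have := dMul_C_mul d b (X ^ i)
      simp only [dMul, Derivation.leibniz_pow, coeffDeriv_X, smul_zero, add_zero] at this ⊢
      rw [← C_mul_X_pow_eq_monomial, ← C_mul_X_pow_eq_monomial, ← C_mul_X_pow_eq_monomial, this,
        pow_succ']
    rw [h, opMul_add_left, opMul_monomial, opMul_monomial, opMul_monomial, dMul_C_mul,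
      Function.iterate_succ_apply']

theorem natDegree_opMul_le {N n : ℕ} {p q : E[X]} (hp : p.natDegree ≤ N) (hq : q.natDegree ≤ n) :
    (opMul d p q).natDegree ≤ n + N := by
  rw [opMul_eq_sum_range d (N := N + 1)
    (degree_le_of_natDegree_le hp |>.trans_lt (by exact_mod_cast N.lt_succ_self))]
  refine natDegree_sum_le_of_forall_le _ _ fun i hi => ?_
  have := natDegree_iterate_dMul_le d hq i
  have := Finset.mem_range.1 hi
  exact (natDegree_C_mul_le _ _).trans (by omega)

theorem coeff_opMul_top {N n : ℕ} {p q : E[X]} (hp : p.natDegree ≤ N) (hq : q.natDegree ≤ n) :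
    (opMul d p q).coeff (n + N) = p.coeff N * q.coeff n := by
  rw [opMul_eq_sum_range d (N := N + 1)
    (degree_le_of_natDegree_le hp |>.trans_lt (by exact_mod_cast N.lt_succ_self)),
    finsetSum_coeff, Finset.sum_range_succ, coeff_C_mul, coeff_iterate_dMul_top d hq,
    Finset.sum_eq_zero, zero_add]
  intro i hi
  have := natDegree_iterate_dMul_le d hq i
  have := Finset.mem_range.1 hi
  rw [coeff_C_mul, coeff_eq_zero_of_natDegree_lt (p := (dMul d)^[i] q) (by omega), mul_zero]

section Map

variable {l F : Type*} [CommRing l] [CommRing F] [Algebra l F] {d} {d' : Derivation l F F}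
  {σ : E →+* F}

theorem dMul_map (hσ : ∀ a, σ (d a) = d' (σ a)) (p : E[X]) :
    (dMul d p).map σ = dMul d' (p.map σ) := by
  simp only [dMul, Polynomial.map_add, Polynomial.map_mul, map_X]
  congr 1
  ext i
  simp [coeff_coeffDeriv, hσ]

theorem iterate_dMul_map (hσ : ∀ a, σ (d a) = d' (σ a)) (i : ℕ) (p : E[X]) :
    ((dMul d)^[i] p).map σ = (dMul d')^[i] (p.map σ) :=
  Function.Semiconj.iterate_right (f := Polynomial.map σ) (fun p => dMul_map hσ p) i p

theorem opMul_map (hσ : ∀ a, σ (d a) = d' (σ a)) (p q : E[X]) :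
    (opMul d p q).map σ = opMul d' (p.map σ) (q.map σ) := by
  induction p using Polynomial.induction_on' with
  | add p₁ p₂ h₁ h₂ =>
    rw [opMul_add_left, Polynomial.map_add, Polynomial.map_add, opMul_add_left, h₁, h₂]
  | monomial i b =>
    rw [opMul_monomial, map_monomial, opMul_monomial, Polynomial.map_mul, map_C,
      iterate_dMul_map hσ]

end Map

end Operators

/-! ### Subresultants through remainders -/

section Subresultant

/-- Block factorization `M = [1 0; T 1] · [A B; 0 R]`: subtracting `T` times the top rows from the
bottom rows clears the lower left block. -/
theorem _root_.Matrix.det_of_bottom_rows_reduced {E : Type*} [CommRing E] {p q N : ℕ}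
    (h : p + q = N) (M : Matrix (Fin N) (Fin N) E) (T : Matrix (Fin q) (Fin p) E)
    (R : Matrix (Fin q) (Fin q) E)
    (h₁ : ∀ (j : Fin q) (b : Fin p), M (Fin.cast h (Fin.natAdd p j)) (Fin.cast h (Fin.castAdd q b)) =
      ∑ a, T j a * M (Fin.cast h (Fin.castAdd q a)) (Fin.cast h (Fin.castAdd q b)))
    (h₂ : ∀ j b : Fin q, M (Fin.cast h (Fin.natAdd p j)) (Fin.cast h (Fin.natAdd p b)) =
      ∑ a, T j a * M (Fin.cast h (Fin.castAdd q a)) (Fin.cast h (Fin.natAdd p b)) + R j b) :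
    M.det = (Matrix.of fun a b : Fin p =>
      M (Fin.cast h (Fin.castAdd q a)) (Fin.cast h (Fin.castAdd q b))).det * R.det := by
  subst h
  set A : Matrix (Fin p) (Fin p) E := Matrix.of fun a b => M (Fin.castAdd q a) (Fin.castAdd q b)
  set B : Matrix (Fin p) (Fin q) E := Matrix.of fun a b => M (Fin.castAdd q a) (Fin.natAdd p b)
  have hM : M.submatrix finSumFinEquiv finSumFinEquiv =
      Matrix.fromBlocks 1 0 T 1 * Matrix.fromBlocks A B 0 R := by
    rw [Matrix.fromBlocks_multiply]
    ext (i | i) (j | j)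
    · simp [A]
    · simp [B]
    · simpa [A, Matrix.mul_apply] using h₁ i j
    · simpa [B, Matrix.mul_apply] using h₂ i j
  rw [← Matrix.det_submatrix_equiv_self finSumFinEquiv M, hM, Matrix.det_mul,
    Matrix.det_fromBlocks_zero₁₂, Matrix.det_fromBlocks_zero₂₁]
  simp [A]

variable {k E : Type*} [CommRing k] [CommRing E] [Algebra k E] (d : Derivation k E E)

theorem coeff_opMul_eq_sum_fin {N : ℕ} {p : E[X]} (hp : p.degree < N) (q : E[X]) (j : ℕ) :
    (opMul d p q).coeff j =
      ∑ a : Fin N, p.coeff (N - 1 - a) * ((dMul d)^[N - 1 - a] q).coeff j := by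
  rw [opMul_eq_sum_range d hp, finsetSum_coeff, ← Finset.sum_range_reflect, Finset.sum_range]
  simp only [coeff_C_mul]

/-- The subresultants of `P` and `Q` in terms of the remainders of `∂ⁱ Q` on right division
by `P`. -/
theorem subresDet_eq_of_remainders {P Q : E[X]} {n m r i : ℕ} (hP : P.natDegree = n)
    (hQ : Q.natDegree = m) (hrn : r < n) (hrm : r ≤ m) (hi : i ≤ r) (q R : Fin (n - r) → E[X])
    (hq : ∀ j, (q j).degree < (m - r : ℕ)) (hR : ∀ j, (R j).natDegree < n)
    (h : ∀ j : Fin (n - r), (dMul d)^[n - 1 - r - j] Q = opMul d (q j) P + R j) :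
    subresDet d P Q r i = P.leadingCoeff ^ (m - r) *
      (Matrix.of fun j b : Fin (n - r) =>
        (R j).coeff (if (b : ℕ) + 1 < n - r then n - 1 - b else i)).det := by
  have hN : (m - r) + (n - r) = n + m - 2 * r := by omega
  subst hP hQ
  -- The coefficients of the quotient `q j` say which combination of the rows `∂ᵃ P` to subtract.
  -- The bound on its degree ensures that only rows present in the matrix occur.
  rw [subresDet, Matrix.det_of_bottom_rows_reduced hN _
    (Matrix.of fun j a => (q j).coeff (Q.natDegree - r - 1 - a))
    (Matrix.of fun j b : Fin (P.natDegree - r) =>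
        (R j).coeff (if (b : ℕ) + 1 < P.natDegree - r then P.natDegree - 1 - b else i))]
  · congr 1
    -- The rows `∂ᵃ P` have strictly decreasing order and the same top coefficient, so their block
    -- is triangular with constant diagonal.
    rw [Matrix.det_of_isUpperTriangular]
    · rw [Finset.prod_congr rfl (g := fun _ => P.leadingCoeff), Finset.prod_const]
      · simp
      intro a _
      have ha := a.2
      have h1 : P.natDegree + Q.natDegree - r - 1 - a =
        P.natDegree + (Q.natDegree - 1 - r - a) := by omega
      have h2 : (a : ℕ) + 1 < P.natDegree + Q.natDegree - 2 * r := by omega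
      simp [sylMinor, sylMatrix, h1, h2, coeff_iterate_dMul_top d le_rfl]
    · intro a b hab
      have ha := a.2
      have hab' : (b : ℕ) < a := hab
      have h2 : (b : ℕ) + 1 < P.natDegree + Q.natDegree - 2 * r := by omega
      simp only [sylMinor, sylMatrix, Matrix.submatrix_apply, Matrix.of_apply, id, Fin.val_cast,
        Fin.val_castAdd, h2, if_true, ha]
      exact coeff_eq_zero_of_natDegree_lt
        ((natDegree_iterate_dMul_le d le_rfl _).trans_lt (by omega))
  · intro j b
    have hb := b.2
    have h2 : (b : ℕ) + 1 < P.natDegree + Q.natDegree - 2 * r := by omega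
    simp only [sylMinor, sylMatrix, Matrix.submatrix_apply, Matrix.of_apply, id, Fin.val_cast,
        Fin.val_castAdd, Fin.val_natAdd, h2, if_true, Fin.is_lt, add_lt_iff_neg_left, not_lt_zero,
        if_false, add_tsub_cancel_left, h]
    -- These columns belong to powers `∂ⁱ` with `i ≥ n`, where the remainder has no coefficient.
    rw [coeff_add, coeff_eq_zero_of_natDegree_lt ((hR j).trans_le _), add_zero,
      coeff_opMul_eq_sum_fin d (hq j)]
    · simp only [Nat.sub_right_comm _ 1 r]
    · omega
  · intro j b
    have hb := b.2
    simp only [sylMinor, sylMatrix, Matrix.submatrix_apply, Matrix.of_apply, id, Fin.val_cast,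
        Fin.val_castAdd, Fin.val_natAdd, Fin.is_lt, if_true, add_lt_iff_neg_left, not_lt_zero,
        if_false, add_tsub_cancel_left, h]
    rw [coeff_add, coeff_opMul_eq_sum_fin d (hq j)]
    simp only [Nat.sub_right_comm _ 1 r]
    congr 2
    split_ifs <;> simp only <;> omega

end Subresultant

/-! ### Division by a second-order operator `-∂² + a` -/

section SecondOrder

variable {k E : Type*} [CommRing k] [CommRing E] [Algebra k E] (d : Derivation k E E)

theorem natDegree_neg_X_sq_add_C [Nontrivial E] (a : E) : (-X ^ 2 + C a : E[X]).natDegree = 2 := by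
  compute_degree!

theorem leadingCoeff_neg_X_sq_add_C [Nontrivial E] (a : E) :
    (-X ^ 2 + C a : E[X]).leadingCoeff = -1 := by
  rw [leadingCoeff, natDegree_neg_X_sq_add_C]
  simp

theorem subresDet_one_of_remainder [Nontrivial E] {a v w : E} {Q q : E[X]} {m i : ℕ}
    (hQ : Q.natDegree = m) (hm : Odd m) (hq : q.degree < (m - 1 : ℕ))
    (h : Q = opMul d q (-X ^ 2 + C a) + (C v * X + C w)) (hi : i ≤ 1) :
    subresDet d (-X ^ 2 + C a) Q 1 i = (C v * X + C w).coeff i := by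
  rw [subresDet_eq_of_remainders d (natDegree_neg_X_sq_add_C a) hQ (r := 1) (by norm_num) hm.pos hi
    (fun _ => q) (fun _ => C v * X + C w) (fun _ => hq)
    (fun _ => natDegree_linear_le.trans_lt (by norm_num)) (fun j => by simpa using h),
    leadingCoeff_neg_X_sq_add_C,
    (Nat.Odd.sub_odd hm odd_one).neg_one_pow, one_mul, Matrix.det_unique (n := Fin 1)]
  simp

/-- Modulo `-∂² + a` the term `v ∂²` of the derivative may be replaced by `v a`. -/
theorem dMul_linear (a v w : E) :
    dMul d (C v * X + C w) = opMul d (C (-v)) (-X ^ 2 + C a) +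
      (C (d v + w) * X + C (d w + v * a)) := by
  rw [opMul_C]
  simp only [dMul, map_add, Derivation.leibniz, coeffDeriv_C, coeffDeriv_X, smul_eq_mul, map_neg,
    map_mul]
  ring

theorem dRes_of_remainder [Nontrivial E] {a v w : E} {Q q : E[X]} {m : ℕ}
    (hQ : Q.natDegree = m) (hm : Odd m) (hq : q.natDegree < m - 1)
    (h : Q = opMul d q (-X ^ 2 + C a) + (C v * X + C w)) :
    dRes d (-X ^ 2 + C a) Q = -((d v + w) * w - (d w + v * a) * v) := by
  have hq' : (dMul d q - C v).natDegree < m := by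
    have h1 := natDegree_iterate_dMul_le d (p := q) le_rfl 1
    have h2 := natDegree_sub_le (dMul d q) (C v)
    simp only [Function.iterate_one, natDegree_C] at h1 h2
    omega
  have hdQ : dMul d Q = opMul d (dMul d q - C v) (-X ^ 2 + C a) +
      (C (d v + w) * X + C (d w + v * a)) := by
    rw [h, dMul_add, dMul_opMul, dMul_linear d a, ← add_assoc, ← opMul_add_left, C_neg,
      sub_eq_add_neg]
  -- The first of the two rows is that of `∂ Q`, the second that of `Q`. The sign is `(-1)^m` with
  -- `m` odd.
  rw [dRes, subresDet_eq_of_remainders d (natDegree_neg_X_sq_add_C a) hQ (by norm_num) (Nat.zero_le _)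
    le_rfl ![dMul d q - C v, q] ![C (d v + w) * X + C (d w + v * a), C v * X + C w]
    _ _ _, leadingCoeff_neg_X_sq_add_C, Matrix.det_fin_two (A := (Matrix.of _ : Matrix (Fin 2) (Fin 2) E)),
    tsub_zero, hm.neg_one_pow]
  · simp
  · intro j
    fin_cases j
    · exact degree_le_natDegree.trans_lt (by exact_mod_cast hq')
    · exact degree_le_natDegree.trans_lt (by exact_mod_cast (by omega : q.natDegree < m))
  · intro j
    fin_cases j <;> exact natDegree_linear_le.trans_lt (by norm_num)
  · intro j
    fin_cases j
    · simpa using hdQ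
    · simpa using h

end SecondOrder

/-! ### Specialization at the potential and division of `P_{2n+1}` by `L - λ` -/

section Reduction

variable {k K : Type*} [Field k] [Field K] [Algebra k K] (d : Derivation k K K)

theorem evalAt_diffPolyDeriv (u : K) (p : MvPolynomial ℕ k) :
    evalAt d u (diffPolyDeriv k p) = d (evalAt d u p) := by
  induction p using MvPolynomial.induction_on with
  | C a => simp [← MvPolynomial.algebraMap_eq]
  | add p q hp hq => rw [map_add, map_add, map_add, map_add, hp, hq]
  | mul_X p i hp =>
    have hX : diffPolyDeriv k (MvPolynomial.X i) = MvPolynomial.X (i + 1) :=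
      MvPolynomial.mkDerivation_X _ _ _
    simp only [Derivation.leibniz, hX, smul_eq_mul, map_add, map_mul, hp]
    simp [evalAt, Function.iterate_succ_apply']

/-- The specialization `k{u} → K ⊆ K[λ,μ]` at the potential `u`. -/
noncomputable def evalPoly (u : K) : MvPolynomial ℕ k →+* K[X][Y] :=
  ((C : K[X] →+* K[X][Y]).comp C).comp (evalAt d u : MvPolynomial ℕ k →+* K)

theorem evalPoly_apply (u : K) (p : MvPolynomial ℕ k) :
    evalPoly d u p = C (C (evalAt d u p)) := rfl

theorem evalPoly_diffPolyDeriv (u : K) (p : MvPolynomial ℕ k) :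
    evalPoly d u (diffPolyDeriv k p) = polyDeriv d (evalPoly d u p) := by
  rw [evalPoly_apply, evalPoly_apply, polyDeriv, coeffDeriv_C, coeffDeriv_C, evalAt_diffPolyDeriv]

/-- The polynomial `∑ vⱼ λⁿ⁻ʲ` at the potential `u`: the coefficient of `∂` in the remainder of
`P_{2n+1}` on division by `L - λ`. -/
noncomputable def remCoeff (k : Type*) [Field k] [Algebra k K] (d : Derivation k K K) (u : K) :
    ℕ → K[X]
  | 0 => 1
  | n + 1 => C (evalAt d u (v k (n + 1))) + X * remCoeff k d u n

theorem natDegree_remCoeff_le (u : K) (n : ℕ) : (remCoeff k d u n).natDegree ≤ n := by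
  induction n with
  | zero => simp [remCoeff]
  | succ n ih =>
    rw [remCoeff]
    refine natDegree_add_le_of_degree_le (by simp) (natDegree_mul_le.trans ?_)
    have := natDegree_X_le (R := K)
    omega

theorem coeff_remCoeff_self (u : K) (n : ℕ) : (remCoeff k d u n).coeff n = 1 := by
  induction n with
  | zero => simp [remCoeff]
  | succ n ih => simp [remCoeff, coeff_X_mul, ih]

theorem evalPoly_smul (u : K) (a : k) (p : MvPolynomial ℕ k) :
    evalPoly d u (a • p) = C (C (algebraMap k K a)) * evalPoly d u p := by
  rw [evalPoly_apply, map_smul, Algebra.smul_def, C_mul, C_mul, evalPoly_apply]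

theorem algebraMap_one_half (k K : Type*) [Field k] [Field K] [Algebra k K] :
    algebraMap k K (1 / 2) = 1 / 2 := by
  rw [one_div, map_inv₀, map_ofNat, one_div]

theorem deriv_evalAt_v_one [CharZero K] (u : K) : d (evalAt d u (v k 1)) = d u / 2 := by
  have hX (i : ℕ) : diffPolyDeriv k (MvPolynomial.X i) = MvPolynomial.X (i + 1) :=
    MvPolynomial.mkDerivation_X _ _ _
  have hex : ∃ q : MvPolynomial ℕ k, diffPolyDeriv k q = MvPolynomial.X 1 * 1 ∧ MvPolynomial.constantCoeff q = 0 :=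
    ⟨MvPolynomial.X 0, by rw [hX, mul_one], by simp⟩
  -- `antideriv` is a choice with default value `0`; the witness `u` for `∂⁻¹ u'` excludes the
  -- default here, and only the defining property of the choice is used.
  have hanti : diffPolyDeriv k (antideriv (MvPolynomial.X 1 * 1)) = MvPolynomial.X 1 * 1 := by
    rw [antideriv, dif_pos hex]
    exact hex.choose_spec.1
  have h1 : evalAt (k := k) d u (MvPolynomial.X 1) = d u := by simp [evalAt]
  rw [← evalAt_diffPolyDeriv]
  simp only [v, map_sub, Derivation.map_one_eq_zero, map_zero, smul_zero, neg_zero,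
    zero_add, mul_one, Derivation.map_smul, hX] at hanti ⊢
  rw [hanti, map_smul, h1, Algebra.smul_def, algebraMap_one_half]
  ring

/-- The subleading coefficient is `v₁` at every stage, because each step shifts by `λ` and adds only
a term of degree 0. -/
theorem deriv_coeff_remCoeff [CharZero K] (u : K) (n : ℕ) :
    d ((remCoeff k d u (n + 1)).coeff n) = d u / 2 := by
  induction n with
  | zero => simp [remCoeff, deriv_evalAt_v_one]
  | succ n ih =>
    rw [remCoeff, coeff_add, coeff_X_mul, coeff_C_succ, zero_add, ih]

theorem polyDeriv_C_X : polyDeriv d (C X) = 0 := by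
  rw [polyDeriv, coeffDeriv_C, coeffDeriv_X, C_0]

theorem polyDeriv_Y : polyDeriv d Y = 0 := coeffDeriv_X _

theorem opLsubLambda_eq (u : K) : opLsubLambda u = -X ^ 2 + C (C (C u - X)) := by
  simp only [opLsubLambda, schrodinger, Polynomial.map_add, Polynomial.map_neg,
    Polynomial.map_pow, map_X, map_C, RingHom.comp_apply, C_sub]
  ring

/-- The quotient of `P_{2n+1}` on right division by `L - λ`. -/
noncomputable def quotOp (k : Type*) [Field k] [Algebra k K] (d : Derivation k K K) (u : K) :
    ℕ → K[X][Y][X]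
  | 0 => 0
  | n + 1 => (kdvOp k n).map (evalPoly d u) + C (C X) * quotOp k d u n

/-- The operator `V ∂ - (1/2) V'`. -/
noncomputable def linearOp (V : K[X]) : K[X][Y][X] :=
  C (C V) * X + C (C (-(C (1 / 2) * coeffDeriv d V)))

theorem linearOp_add (V W : K[X]) : linearOp d (V + W) = linearOp d V + linearOp d W := by
  simp only [linearOp, map_add, mul_add, neg_add]
  ring

theorem linearOp_sum {ι : Type*} (t : Finset ι) (V : ι → K[X]) :
    linearOp d (∑ i ∈ t, V i) = ∑ i ∈ t, linearOp d (V i) :=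
  map_sum (AddMonoidHom.mk' (linearOp d) (linearOp_add d)) V t

theorem linearOp_const_mul {p : K[X]} (hp : coeffDeriv d p = 0) (V : K[X]) :
    linearOp d (p * V) = C (C p) * linearOp d V := by
  simp only [linearOp, Derivation.leibniz, hp, smul_eq_mul, mul_zero, add_zero, map_neg, map_mul]
  ring

theorem map_schrodinger (u : K) :
    (schrodinger (MvPolynomial.X 0 : MvPolynomial ℕ k)).map (evalPoly d u) =
      opLsubLambda u + C (C X) := by
  rw [opLsubLambda_eq, add_assoc, ← C_add, ← C_add, sub_add_cancel]
  simp [schrodinger, evalPoly_apply, evalAt]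

theorem map_kdvOp_succ [CharZero K] (u : K) (n : ℕ) :
    (kdvOp k (n + 1)).map (evalPoly d u) =
      linearOp d (C (evalAt d u (v k (n + 1)))) + opMul (polyDeriv d)
        ((kdvOp k n).map (evalPoly d u)) (opLsubLambda u + C (C X)) := by
  rw [kdvOp, Polynomial.map_add, opMul_map (evalPoly_diffPolyDeriv d u), map_schrodinger]
  congr 1
  rw [Polynomial.map_sub, Polynomial.map_mul, map_C, map_X, map_C, evalPoly_smul,
    algebraMap_one_half, evalPoly_apply, evalPoly_apply, evalAt_diffPolyDeriv, linearOp,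
    coeffDeriv_C, C_neg, C_neg, C_mul, C_mul, C_mul, sub_eq_add_neg]

/-- In the recursion `P L = P (L - λ) + λ P`: the first summand goes into the quotient, and the
second multiplies the previous division by the constant `λ`. -/
theorem map_kdvOp_eq [CharZero K] (u : K) (n : ℕ) :
    (kdvOp k n).map (evalPoly d u) =
      opMul (polyDeriv d) (quotOp k d u n) (opLsubLambda u) + linearOp d (remCoeff k d u n) := by
  induction n with
  | zero => simp [kdvOp, quotOp, opMul_zero_left, linearOp, remCoeff]
  | succ n ih =>
    have hl : linearOp d (remCoeff k d u (n + 1)) =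
        linearOp d (C (evalAt d u (v k (n + 1)))) + C (C X) * linearOp d (remCoeff k d u n) := by
      rw [remCoeff, linearOp_add, linearOp_const_mul d (coeffDeriv_X d)]
    rw [map_kdvOp_succ, opMul_add_right, opMul_C_right _ (polyDeriv_C_X d), quotOp, opMul_add_left,
      opMul_C_mul_left, hl]
    conv_lhs => rw [ih]
    conv_rhs => rw [ih]
    ring

theorem natDegree_map_kdvOp_le [CharZero K] (u : K) (n : ℕ) :
    ((kdvOp k n).map (evalPoly d u)).natDegree ≤ 2 * n + 1 ∧
      ((kdvOp k n).map (evalPoly d u)).coeff (2 * n + 1) = (-1) ^ n := by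
  have hlin (V : K[X]) : (linearOp d V).natDegree ≤ 1 := natDegree_linear_le
  induction n with
  | zero => simp [kdvOp]
  | succ n ih =>
    have hL : (opLsubLambda u + C (C X)).natDegree ≤ 2 ∧
        (opLsubLambda u + C (C X)).coeff 2 = -1 := by
      rw [opLsubLambda_eq, add_assoc, ← C_add]
      refine ⟨(natDegree_neg_X_sq_add_C _).le, ?_⟩
      simp
    have h1 := natDegree_opMul_le (polyDeriv d) ih.1 hL.1
    have h2 := coeff_opMul_top (polyDeriv d) ih.1 hL.1
    rw [map_kdvOp_succ]
    have hV := hlin (C (evalAt d u (v k (n + 1))))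
    refine ⟨natDegree_add_le_of_degree_le (by omega) (by omega), ?_⟩
    rw [coeff_add, coeff_eq_zero_of_natDegree_lt (p := linearOp _ _) (by omega),
      show 2 * (n + 1) + 1 = 2 + (2 * n + 1) by ring, h2, ih.2, hL.2]
    ring

theorem degree_C_mul_le {R : Type*} [CommRing R] (a : R) (p : R[X]) :
    (C a * p).degree ≤ p.degree := by
  rw [C_mul']
  exact degree_smul_le a p

theorem degree_quotOp_lt [CharZero K] (u : K) (n : ℕ) :
    (quotOp k d u n).degree < (2 * n : ℕ) := by
  induction n with
  | zero => simp [quotOp]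
  | succ n ih =>
    rw [quotOp]
    refine (degree_add_le _ _).trans_lt (max_lt ?_ ?_)
    · exact (degree_le_of_natDegree_le (natDegree_map_kdvOp_le d u n).1).trans_lt
        (by exact_mod_cast (by omega : 2 * n + 1 < 2 * (n + 1)))
    · refine (degree_C_mul_le _ _).trans_lt (ih.trans ?_)
      exact_mod_cast (by omega : 2 * n < 2 * (n + 1))

/-! ### Division of `A_{2s+1} - μ` by `L - λ` -/

variable (u : K) (s : ℕ) (c : Fin s → k)

/-- The coefficient of `∂` in the remainder of `A_{2s+1}` on division by `L - λ`. -/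
noncomputable def hatCoeff : K[X] :=
  remCoeff k d u s + ∑ l : Fin s, C (algebraMap k K (c l.rev)) * remCoeff k d u l

/-- The quotient of `A_{2s+1} - μ` on right division by `L - λ`. -/
noncomputable def hatQuot : K[X][Y][X] :=
  quotOp k d u s + ∑ l : Fin s, C (C (C (algebraMap k K (c l.rev)))) * quotOp k d u l

theorem map_opA : (opA d u s c).map ((C : K[X] →+* K[X][Y]).comp C) =
    (kdvOp k s).map (evalPoly d u) +
      ∑ l : Fin s, C (C (C (algebraMap k K (c l.rev)))) * (kdvOp k l).map (evalPoly d u) := by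
  rw [opA, Polynomial.map_map]
  change (kdvOpHat s c).map (evalPoly d u) = _
  rw [kdvOpHat, Polynomial.map_add, Polynomial.map_sum]
  congr 1
  refine Finset.sum_congr rfl fun l _ => ?_
  ext1 i
  rw [coeff_map, coeff_smul, evalPoly_smul, coeff_C_mul, coeff_map]

theorem opAsubMu_eq [CharZero K] :
    opAsubMu d u s c = opMul (polyDeriv d) (hatQuot d u s c) (opLsubLambda u) +
      (C (C (hatCoeff d u s c)) * X +
        C (-(Y + C (C (1 / 2) * coeffDeriv d (hatCoeff d u s c))))) := by
  have hl : linearOp d (hatCoeff d u s c) = linearOp d (remCoeff k d u s) +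
      ∑ l : Fin s, C (C (C (algebraMap k K (c l.rev)))) * linearOp d (remCoeff k d u l) := by
    rw [hatCoeff, linearOp_add, linearOp_sum]
    congr 1
    refine Finset.sum_congr rfl fun l _ => linearOp_const_mul d ?_ _
    rw [coeffDeriv_C, Derivation.map_algebraMap, C_0]
  have hC : C (C (hatCoeff d u s c)) * X +
      C (-(Y + C (C (1 / 2) * coeffDeriv d (hatCoeff d u s c)))) =
        linearOp d (hatCoeff d u s c) - C Y := by
    simp only [linearOp, C_neg, neg_add, C_add]; ring
  rw [opAsubMu, map_opA, hC, hl, hatQuot, opMul_add_left, opMul_sum_left]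
  simp only [opMul_C_mul_left, map_kdvOp_eq, mul_add, Finset.sum_add_distrib]
  ring

theorem natDegree_opAsubMu [CharZero K] : (opAsubMu d u s c).natDegree = 2 * s + 1 := by
  have h := natDegree_map_kdvOp_le (k := k) d u s
  have hsum : (∑ l : Fin s, C (C (C (algebraMap k K (c l.rev)))) *
      (kdvOp k l).map (evalPoly d u)).natDegree ≤ 2 * s := by
    refine natDegree_sum_le_of_forall_le _ _ fun l _ => (natDegree_C_mul_le _ _).trans ?_
    have := (natDegree_map_kdvOp_le (k := k) d u l).1
    have := l.2
    omega
  rw [opAsubMu, map_opA]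
  refine natDegree_eq_of_le_of_coeff_ne_zero ?_ ?_
  · refine (natDegree_sub_le _ _).trans (max_le ?_ (by simp))
    exact natDegree_add_le_of_degree_le h.1 (by omega)
  · rw [coeff_sub, coeff_add, coeff_eq_zero_of_natDegree_lt (p := Finset.sum _ _) (by omega), h.2,
      coeff_C_succ, add_zero, sub_zero]
    exact pow_ne_zero _ (neg_ne_zero.2 one_ne_zero)

theorem degree_hatQuot_lt [CharZero K] : (hatQuot d u s c).degree < (2 * s : ℕ) := by
  refine (degree_add_le _ _).trans_lt (max_lt (degree_quotOp_lt d u s) ?_)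
  refine (degree_sum_le _ _).trans_lt ((Finset.sup_lt_iff (WithBot.bot_lt_coe _)).2 fun l _ => ?_)
  refine (degree_C_mul_le _ _).trans_lt ((degree_quotOp_lt d u l).trans ?_)
  exact_mod_cast (by omega : 2 * (l : ℕ) < 2 * s)

theorem natDegree_hatCoeff_le : (hatCoeff d u s c).natDegree ≤ s := by
  refine natDegree_add_le_of_degree_le (natDegree_remCoeff_le d u s) ?_
  refine natDegree_sum_le_of_forall_le _ _ fun l _ => (natDegree_C_mul_le _ _).trans ?_
  exact (natDegree_remCoeff_le d u l).trans l.2.le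

theorem coeff_hatCoeff_self : (hatCoeff d u s c).coeff s = 1 := by
  rw [hatCoeff, coeff_add, coeff_remCoeff_self, finsetSum_coeff, Finset.sum_eq_zero, add_zero]
  intro l _
  rw [coeff_C_mul, coeff_eq_zero_of_natDegree_lt ((natDegree_remCoeff_le d u l).trans_lt l.2),
    mul_zero]

theorem deriv_coeff_hatCoeff [CharZero K] (hs : 1 ≤ s) :
    d ((hatCoeff d u s c).coeff (s - 1)) = d u / 2 := by
  obtain ⟨n, rfl⟩ := Nat.exists_eq_add_of_le' hs
  rw [Nat.add_sub_cancel, hatCoeff, coeff_add, map_add, deriv_coeff_remCoeff, finsetSum_coeff,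
    map_sum, Finset.sum_eq_zero, add_zero]
  intro l _
  rw [coeff_C_mul]
  -- Only the last summand reaches this degree; being monic, it contributes a constant, which the
  -- derivation kills.
  rcases (Nat.lt_succ_iff.1 l.2).lt_or_eq with h | h
  · rw [coeff_eq_zero_of_natDegree_lt ((natDegree_remCoeff_le d u l).trans_lt h), mul_zero, map_zero]
  · have h1 : (remCoeff k d u l).coeff n = 1 := by
      have h2 (m : ℕ) (hm : (l : ℕ) = m) : (remCoeff k d u l).coeff m = 1 :=
        hm ▸ coeff_remCoeff_self d u _
      exact h2 n h
    rw [h1, mul_one, Derivation.map_algebraMap]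

/-! ### The subresultants and the equation of the spectral curve -/

theorem phi1_eq [CharZero K] :
    phi1 d u s c = -(Y + C (C (1 / 2) * coeffDeriv d (hatCoeff d u s c))) := by
  have h := opAsubMu_eq d u s c
  rw [opLsubLambda_eq] at h
  rw [phi1, opLsubLambda_eq, subresDet_one_of_remainder (polyDeriv d) (natDegree_opAsubMu d u s c)
    ⟨s, rfl⟩ (degree_hatQuot_lt d u s c) h zero_le_one]
  simp

theorem phi2_eq [CharZero K] : phi2 d u s c = C (hatCoeff d u s c) := by
  have h := opAsubMu_eq d u s c
  rw [opLsubLambda_eq] at h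
  rw [phi2, opLsubLambda_eq, subresDet_one_of_remainder (polyDeriv d) (natDegree_opAsubMu d u s c)
    ⟨s, rfl⟩ (degree_hatQuot_lt d u s c) h le_rfl]
  simp

theorem spectralPoly_eq [CharZero K] (hs : 1 ≤ s) {φ α : K[X]} (hφ : φ = hatCoeff d u s c)
    (hα : α = C (1 / 2) * coeffDeriv d φ) :
    spectralPoly d u s c =
      -(Y ^ 2 - C (α ^ 2 - φ * coeffDeriv d α + φ ^ 2 * (C u - X))) := by
  have h := opAsubMu_eq d u s c
  rw [opLsubLambda_eq, ← hφ, ← hα] at h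
  have hdeg : (hatQuot d u s c).natDegree < 2 * s + 1 - 1 := by
    -- For a zero quotient `natDegree` is `0`, and the strict bound comes from `1 ≤ s`.
    rcases eq_or_ne (hatQuot d u s c) 0 with h0 | h0
    · rw [h0, natDegree_zero]; omega
    · exact (natDegree_lt_iff_degree_lt h0).2 (degree_hatQuot_lt d u s c)
  have h2 : coeffDeriv d φ = 2 * α := by
    rw [hα, ← mul_assoc, ← C_ofNat, ← C_mul]
    norm_num
  -- Here `y` is `μ`, with the `0` standing for its derivative; `a`, `b`, `f`, `g` are `α`, `α'`,
  -- `φ`, `u - λ`. The terms linear in `μ` cancel because `φ' = 2α`.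
  have key {A : Type _} [CommRing A] (y a b f g : A) :
      -((2 * a + -(y + a)) * -(y + a) - (-(0 + b) + f * g) * f) =
        -(y ^ 2 - (a ^ 2 - f * b + f ^ 2 * g)) := by ring
  rw [spectralPoly, opLsubLambda_eq, dRes_of_remainder (polyDeriv d) (natDegree_opAsubMu d u s c)
    ⟨s, rfl⟩ hdeg h, map_neg, map_add, polyDeriv_Y, polyDeriv, coeffDeriv_C, coeffDeriv_C, h2,
    C_mul, C_ofNat, key]
  simp only [C_add, C_sub, C_mul, C_pow]

/-- A monic quadratic over a domain is reducible only if it has a root, and `x² = R` would make the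
degree of `R` even. -/
theorem irreducible_Y_sq_sub_C {R : K[X]} (hR : Odd R.natDegree) :
    Irreducible (Y ^ 2 - C R : K[X][Y]) := by
  have hdeg : (Y ^ 2 - C R : K[X][Y]).natDegree = 2 := natDegree_X_pow_sub_C
  refine (Monic.irreducible_iff_roots_eq_zero_of_degree_le_three
    (monic_X_pow_sub_C R two_ne_zero) hdeg.ge (by omega)).2 ?_
  refine Multiset.eq_zero_of_forall_notMem fun x hx => ?_
  have hx : x ^ 2 = R := by simpa [sub_eq_zero] using (mem_roots'.1 hx).2
  rw [← hx, natDegree_pow] at hR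
  exact absurd hR (by simp)

/-- The term `-λ φ²` dominates: the other products have degree at most `2s`. -/
theorem natDegree_curve {φ α : K[X]} (h₁ : φ.natDegree ≤ s) (h₂ : φ.coeff s = 1)
    (h₃ : α.natDegree ≤ s) :
    (α ^ 2 - φ * coeffDeriv d α + φ ^ 2 * (C u - X)).natDegree = 2 * s + 1 := by
  have h₁' : φ.natDegree = s := natDegree_eq_of_le_of_coeff_ne_zero h₁ (by simp [h₂])
  have h₀ : φ ≠ 0 := by rintro rfl; simp at h₂
  have hd := (natDegree_coeffDeriv_le d α).trans h₃
  have hX : (C u - X : K[X]).natDegree = 1 := by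
    rw [← neg_sub, natDegree_neg, natDegree_X_sub_C]
  have hX0 : (C u - X : K[X]) ≠ 0 := fun h => by simp [h] at hX
  have hlow : (α ^ 2 - φ * coeffDeriv d α).natDegree < (φ ^ 2 * (C u - X)).natDegree := by
    rw [natDegree_mul (pow_ne_zero _ h₀) hX0, natDegree_pow, h₁', hX, Nat.lt_succ_iff]
    refine (natDegree_sub_le _ _).trans (max_le ?_ ?_)
    · rw [natDegree_pow]; omega
    · exact natDegree_mul_le.trans (by omega)
  rw [natDegree_add_eq_right_of_natDegree_lt hlow, natDegree_mul (pow_ne_zero _ h₀) hX0,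
    natDegree_pow, h₁', hX]

end Reduction

end KdV

/-! ### The main theorem -/

open KdV in
theorem mainTheorem8 {k K : Type*} [Field k] [IsAlgClosed k] [Field K] [CharZero K] [Algebra k K]
    (d : Derivation k K K) (hconst : ∀ x : K, d x = 0 → x ∈ Set.range (algebraMap k K))
    (u : K) (s : ℕ) (hs : KdV.IsKdVPotential d u s)
    (c : Fin s → k) (hc : c ∈ KdV.constantsSet d u s) :
    ∃ _ : IsDomain (KdV.CoordRing d u s c), ∃ α φ : K[X],
      φ ≠ 0 ∧ (d u ≠ 0 → α ≠ 0) ∧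
      KdV.phi1 d u s c = -(Y + C α) ∧ KdV.phi2 d u s c = C φ ∧
      KdV.toFunctionField d u s c (C φ) ≠ 0 ∧
      KdV.factorCoeff d u s c =
        KdV.toFunctionField d u s c (Y + C α) / KdV.toFunctionField d u s c (C φ) ∧
      KdV.factorCoeff d u s c ≠ 0 := by
  have hs1 : 1 ≤ s := hs.1.1
  set φ := hatCoeff d u s c with hφ
  set α := C (1 / 2) * coeffDeriv d φ with hα
  have hφs : φ.coeff s = 1 := coeff_hatCoeff_self d u s c
  have hφd : φ.natDegree ≤ s := natDegree_hatCoeff_le d u s c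
  have hφ0 : φ ≠ 0 := fun h => by simp [h] at hφs
  have hαd : α.natDegree ≤ s :=
    (natDegree_C_mul_le _ _).trans ((natDegree_coeffDeriv_le d φ).trans hφd)
  have hf := spectralPoly_eq d u s c hs1 hφ hα
  set R := α ^ 2 - φ * coeffDeriv d α + φ ^ 2 * (C u - X)
  have hR : Odd R.natDegree := ⟨s, natDegree_curve d u s hφd hφs hαd⟩
  have hprime : Prime (spectralPoly d u s c) := by
    rw [hf]
    exact (irreducible_Y_sq_sub_C hR).prime.neg
  have hfd : (spectralPoly d u s c).degree = 2 := by
    rw [hf, degree_neg]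
    exact degree_X_pow_sub_C two_pos R
  have hdom : IsDomain (CoordRing d u s c) := AdjoinRoot.isDomain_of_prime hprime
  -- A nonzero multiple of `f_s` has degree at least 2 in `μ`.
  have hne {p : K[X][Y]} (hp : p ≠ 0) (hpd : p.degree < 2) : toFunctionField d u s c p ≠ 0 := by
    intro h
    rw [toFunctionField, RingHom.comp_apply,
      IsFractionRing.to_map_eq_zero_iff (K := FunctionField d u s c), AdjoinRoot.mk_eq_zero] at h
    exact absurd (degree_le_of_dvd h hp) (by rw [hfd, not_le]; exact hpd)
  have hCφ : toFunctionField d u s c (C φ) ≠ 0 :=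
    hne (C_ne_zero.2 hφ0) (degree_C_le.trans_lt (by norm_num))
  have hYα : toFunctionField d u s c (Y + C α) ≠ 0 :=
    hne (X_add_C_ne_zero α) (by rw [degree_X_add_C]; norm_num)
  have hfac : factorCoeff d u s c =
      toFunctionField d u s c (Y + C α) / toFunctionField d u s c (C φ) := by
    rw [factorCoeff, phi1_eq, phi2_eq, map_neg, neg_neg]
  refine ⟨hdom, α, φ, hφ0, fun hu h0 => ?_, phi1_eq d u s c, phi2_eq d u s c, hCφ, hfac, ?_⟩
  -- The coefficient of `λ^(s-1)` in `α = φ'/2` is `u'/4`.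
  · have h1 := congrArg (fun p => p.coeff (s - 1)) h0
    simp only [hα, coeff_C_mul, coeff_coeffDeriv, hφ, deriv_coeff_hatCoeff d u s c hs1,
      coeff_zero] at h1
    exact hu (by simpa using h1)
  · rw [hfac]
    exact div_ne_zero hYα hCφ
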